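/- Let $k$ be a field and let $(\mathcal B,\mathbb E,\mathfrak s)$ be a Krull–Schmidt, Hom-finite, $k$-linear extriangulated category (in the sense of Nakaoka–Palu) with enough projectives and enough injectives which satisfies condition (WIC): for all morphisms $f\colon A\to B$ and $g\colon B\to C$ in $\mathcal B$, if $g\circ f$ is an inflation then so is $f$, and if $g\circ f$ is a deflation then so is $g$. Conventions. Let $\mathcal P$ and $\mathcal I$ be the full subcategories of projective and of injective objects. By a subcategory of $\mathcal B$ we mean a full subcategory closed under isomorphisms, finite direct sums and direct summands. For $n\ge 1$ put $\mathbb E^{n}(X,Y):=\mathbb E(\Omega^{n-1}X,Y)$, where $\Omega^0X=X$ and $\Omega^{i}X$ sits in an $\mathbb E$-triangle $\Omega^{i}X\to P\to\Omega^{i-1}X\dashrightarrow$ with $P\in\mathcal P$. For an object $X$ let $\operatorname{pd}X=\sup\{n\ge1\mid \mathbb E^n(X,Y)\ne0\text{ for some }Y\in\mathcal B\}$ and $\operatorname{id}X=\sup\{n\ge 1\mid \mathbb E^n(Y,X)\ne0\text{ for some }Y\in\mathcal B\}$ (with $\sup\emptyset=0$), and for a class $\mathcal C$ of objects let $\operatorname{pd}\mathcal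 C$ and $\operatorname{id}\mathcal C$ be the suprema of these dimensions over the objects of $\mathcal C$. For a subcategory $\mathcal C$ let $\mathcal C^{\vee}_0=\mathcal C^{\wedge}_0=\mathcal C$ and, for $i\ge1$, let $\mathcal C^{\vee}_i$ consist of the objects $X$ that admit an $\mathbb E$-triangle $X\to C\to D\dashrightarrow$ with $C\in\mathcal C$, $D\in\mathcal C^\vee_{i-1}$, and $\mathcal C^{\wedge}_i$ of the objects $X$ that admit an $\mathbb E$-triangle $D\to C\to X\dashrightarrow$ with $D\in\mathcal C^\wedge_{i-1}$, $C\in\mathcal C$. A subcategory $\mathcal T$ is tilting if for some $n\ge1$ one has $\operatorname{pd}\mathcal T\le n$, $\mathbb E^i(\mathcal T,\mathcal T)=0$ for $1\le i\le n$, and $\mathcal P\subseteq\mathcal T^\vee_n$. It is cotilting if for some $n\ge1$ one has $\operatorname{id}\mathcal T\le n$, $\mathbb E^i(\mathcal T,\mathcal T)=0$ for $1\le i\le n$, and $\mathcal I\subseteq\mathcal T^\wedge_n$. It is tilting-cotilting if it is both. The category $\mathcal B$ is Gorenstein if $\operatorname{pd}\mathcal I<\infty$ and $\operatorname{id}\mathcal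 P<\infty$. Theorem. Assume condition (AF): either $\mathcal B$ is an abelian category (with its short exact sequences as the $\mathbb E$-triangles), or $\mathcal P$ is covariantly finite and $\mathcal I$ is contravariantly finite in $\mathcal B$. Then the following are equivalent: (1) $\mathcal B$ is Gorenstein; (2) every tilting subcategory of $\mathcal B$ is cotilting; (3) every cotilting subcategory of $\mathcal B$ is tilting; (4) $\mathcal B$ has a tilting-cotilting subcategory. -/

import Mathlib

open CategoryTheory CategoryTheory.Limits Opposite

universe w v u

/-- Elements of `E(C, A)` for a bifunctor `E`, contravariant in the first variable: the
`E`-extensions of `C` by `A`. -/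
abbrev Extn {B : Type u} [Category.{v} B] (E : Bᵒᵖ ⥤ B ⥤ AddCommGrpCat.{w}) (C A : B) : Type w :=
  (E.obj (op C)).obj A

/-- The extension `a_* δ = E(C, a)(δ)`. -/
abbrev Extn.push {B : Type u} [Category.{v} B] {E : Bᵒᵖ ⥤ B ⥤ AddCommGrpCat.{w}} {C A A' : B}
    (a : A ⟶ A') (δ : Extn E C A) : Extn E C A' :=
  ((E.obj (op C)).map a).hom δ

/-- The extension `c^* δ = E(c, A)(δ)`. -/
abbrev Extn.pull {B : Type u} [Category.{v} B] {E : Bᵒᵖ ⥤ B ⥤ AddCommGrpCat.{w}} {C C' A : B}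
    (c : C' ⟶ C) (δ : Extn E C A) : Extn E C' A :=
  ((E.map c.op).app A).hom δ

/-- The structure `(E, s)` of an extriangulated category (Nakaoka-Palu) on an additive category `B`.
The realization `s`, which sends an extension `δ` in `E(C, A)` to an equivalence class of sequences
`A ⟶ X ⟶ C`, is encoded by the relation `IsTriangle x y δ` saying that `A ⟶ X ⟶ C` belongs
to the class `s(δ)`. -/
structure Extriangulation (B : Type u) [Category.{v} B] [Preadditive B]
    [HasBinaryBiproducts B] where
  /-- the additive bifunctor of extensions -/
  E : Bᵒᵖ ⥤ B ⥤ AddCommGrpCat.{w}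
  additive_left : E.Additive
  additive_right : ∀ C : Bᵒᵖ, (E.obj C).Additive
  /-- the sequence `x, y` belongs to the class `s(δ)` -/
  IsTriangle : ∀ {A X C : B}, (A ⟶ X) → (X ⟶ C) → Extn E C A → Prop
  /-- `s(δ)` is non-empty. -/
  exists_triangle : ∀ {A C : B} (δ : Extn E C A),
    ∃ (X : B) (x : A ⟶ X) (y : X ⟶ C), IsTriangle x y δ
  /-- `s(δ)` is a single equivalence class, two sequences being equivalent when there is an
  isomorphism of the middle terms that is compatible with the identities of the end terms. -/
  triangle_iff : ∀ {A X C : B} {x : A ⟶ X} {y : X ⟶ C} {δ : Extn E C A}, IsTriangle x y δ →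
    ∀ {X' : B} (x' : A ⟶ X') (y' : X' ⟶ C),
      IsTriangle x' y' δ ↔ ∃ b : X ≅ X', x ≫ b.hom = x' ∧ b.hom ≫ y' = y
  /-- `s` is a realization: a morphism of extensions lifts to a morphism of sequences. -/
  realize : ∀ {A X C A' X' C' : B} {x : A ⟶ X} {y : X ⟶ C} {δ : Extn E C A}
    {x' : A' ⟶ X'} {y' : X' ⟶ C'} {δ' : Extn E C' A'},
    IsTriangle x y δ → IsTriangle x' y' δ' →
    ∀ (a : A ⟶ A') (c : C ⟶ C'), Extn.push a δ = Extn.pull c δ' →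
      ∃ b : X ⟶ X', x ≫ b = a ≫ x' ∧ y ≫ c = b ≫ y'
  /-- `s` is additive, first part: the zero extension is realized by the split sequence. -/
  triangle_zero : ∀ A C : B,
    IsTriangle (biprod.inl : A ⟶ A ⊞ C) (biprod.snd : A ⊞ C ⟶ C) (0 : Extn E C A)
  /-- `s` is additive, second part: `s(δ ⊕ δ') = s(δ) ⊕ s(δ')`. -/
  triangle_sum : ∀ {A X C A' X' C' : B} {x : A ⟶ X} {y : X ⟶ C} {δ : Extn E C A}
    {x' : A' ⟶ X'} {y' : X' ⟶ C'} {δ' : Extn E C' A'},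
    IsTriangle x y δ → IsTriangle x' y' δ' →
    IsTriangle (biprod.map x x') (biprod.map y y')
      (Extn.push (biprod.inl : A ⟶ A ⊞ A') (Extn.pull (biprod.fst : C ⊞ C' ⟶ C) δ) +
        Extn.push (biprod.inr : A' ⟶ A ⊞ A') (Extn.pull (biprod.snd : C ⊞ C' ⟶ C') δ'))
  /-- Axiom (ET3). -/
  et3 : ∀ {A X C A' X' C' : B} {x : A ⟶ X} {y : X ⟶ C} {δ : Extn E C A}
    {x' : A' ⟶ X'} {y' : X' ⟶ C'} {δ' : Extn E C' A'},
    IsTriangle x y δ → IsTriangle x' y' δ' →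
    ∀ (a : A ⟶ A') (b : X ⟶ X'), x ≫ b = a ≫ x' →
      ∃ c : C ⟶ C', y ≫ c = b ≫ y' ∧ Extn.push a δ = Extn.pull c δ'
  /-- Axiom (ET3)ᵒᵖ. -/
  et3_op : ∀ {A X C A' X' C' : B} {x : A ⟶ X} {y : X ⟶ C} {δ : Extn E C A}
    {x' : A' ⟶ X'} {y' : X' ⟶ C'} {δ' : Extn E C' A'},
    IsTriangle x y δ → IsTriangle x' y' δ' →
    ∀ (b : X ⟶ X') (c : C ⟶ C'), y ≫ c = b ≫ y' →
      ∃ a : A ⟶ A', x ≫ b = a ≫ x' ∧ Extn.push a δ = Extn.pull c δ'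
  /-- Axiom (ET4). -/
  et4 : ∀ {A X D Y F : B} {f : A ⟶ X} {f' : X ⟶ D} {δ : Extn E D A}
    {g : X ⟶ Y} {g' : Y ⟶ F} {δ' : Extn E F X},
    IsTriangle f f' δ → IsTriangle g g' δ' →
      ∃ (Z : B) (h' : Y ⟶ Z) (d : D ⟶ Z) (e : Z ⟶ F) (δ'' : Extn E Z A),
        g ≫ h' = f' ≫ d ∧ h' ≫ e = g' ∧
        IsTriangle (f ≫ g) h' δ'' ∧
        IsTriangle d e (Extn.push f' δ') ∧
        Extn.pull d δ'' = δ ∧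
        Extn.push f δ'' = Extn.pull e δ'
  /-- Axiom (ET4)ᵒᵖ. -/
  et4_op : ∀ {D Y X F C : B} {f' : D ⟶ Y} {f : Y ⟶ X} {δ : Extn E X D}
    {g' : F ⟶ X} {g : X ⟶ C} {δ' : Extn E C F},
    IsTriangle f' f δ → IsTriangle g' g δ' →
      ∃ (Z : B) (d : D ⟶ Z) (e : Z ⟶ F) (h' : Z ⟶ Y) (δ'' : Extn E C Z),
        d ≫ h' = f' ∧ e ≫ g' = h' ≫ f ∧
        IsTriangle h' (f ≫ g) δ'' ∧
        IsTriangle d e (Extn.pull g' δ) ∧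
        Extn.push e δ'' = δ' ∧
        Extn.push d δ = Extn.pull g δ''

/-- A Krull-Schmidt category: every object is a finite direct sum of objects with local
endomorphism rings. -/
def IsKrullSchmidt (B : Type u) [Category.{v} B] [Preadditive B] : Prop :=
  ∀ X : B, ∃ (n : ℕ) (F : Fin n → B) (b : Bicone F), Nonempty b.IsBilimit ∧ Nonempty (X ≅ b.pt) ∧
    ∀ i, IsLocalRing (End (F i))

/-- A `k`-linear category whose morphism spaces are finite dimensional. -/
def IsHomFinite (k : Type*) [Field k] (B : Type u) [Category.{v} B] [Preadditive B]
    [Linear k B] : Prop :=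
  ∀ X Y : B, Module.Finite k (X ⟶ Y)

/-- A class of objects that is (the class of objects of) a full subcategory closed under
isomorphisms, finite direct sums (the empty one included) and direct summands. -/
structure IsAdditiveSubcategory {B : Type u} [Category.{v} B] [Preadditive B]
    [HasBinaryBiproducts B] (T : ObjectProperty B) : Prop where
  of_iso : ∀ {X Y : B}, (X ≅ Y) → T X → T Y
  zero : ∀ {X : B}, IsZero X → T X
  sum : ∀ {X Y : B}, T X → T Y → T (X ⊞ Y)
  summand : ∀ {X Y : B}, T (X ⊞ Y) → T X

/-- Covariantly finite: every object has a left approximation. -/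
def IsCovariantlyFinite {B : Type u} [Category.{v} B] (T : ObjectProperty B) : Prop :=
  ∀ X : B, ∃ (Y : B) (f : X ⟶ Y), T Y ∧ ∀ (Z : B) (g : X ⟶ Z), T Z → ∃ h : Y ⟶ Z, f ≫ h = g

/-- Contravariantly finite: every object has a right approximation. -/
def IsContravariantlyFinite {B : Type u} [Category.{v} B] (T : ObjectProperty B) : Prop :=
  ∀ X : B, ∃ (Y : B) (f : Y ⟶ X), T Y ∧ ∀ (Z : B) (g : Z ⟶ X), T Z → ∃ h : Z ⟶ Y, h ≫ f = g

namespace Extriangulation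

section

variable {B : Type u} [Category.{v} B] [Preadditive B] [HasBinaryBiproducts B]
  (S : Extriangulation.{w} B)

/-- The sequence `x, y` is part of an `E`-triangle. -/
def IsConflation {A X C : B} (x : A ⟶ X) (y : X ⟶ C) : Prop :=
  ∃ δ : Extn S.E C A, S.IsTriangle x y δ

def IsInflation {A X : B} (x : A ⟶ X) : Prop :=
  ∃ (C : B) (y : X ⟶ C), S.IsConflation x y

def IsDeflation {X C : B} (y : X ⟶ C) : Prop :=
  ∃ (A : B) (x : A ⟶ X), S.IsConflation x y

/-- Condition (WIC). -/
def WIC : Prop :=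
  (∀ {X Y Z : B} (f : X ⟶ Y) (g : Y ⟶ Z), S.IsInflation (f ≫ g) → S.IsInflation f) ∧
    ∀ {X Y Z : B} (f : X ⟶ Y) (g : Y ⟶ Z), S.IsDeflation (f ≫ g) → S.IsDeflation g

/-- The class of projective objects. -/
def projectives : ObjectProperty B := fun P =>
  ∀ {A X C : B} (x : A ⟶ X) (y : X ⟶ C), S.IsConflation x y →
    ∀ c : P ⟶ C, ∃ b : P ⟶ X, b ≫ y = c

/-- The class of injective objects. -/
def injectives : ObjectProperty B := fun I =>
  ∀ {A X C : B} (x : A ⟶ X) (y : X ⟶ C), S.IsConflation x y →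
    ∀ a : A ⟶ I, ∃ b : X ⟶ I, x ≫ b = a

/-- Every object is the end term of a conflation with projective middle term. -/
class EnoughProjectives : Prop where
  exists_conflation : ∀ C : B, ∃ (A P : B) (x : A ⟶ P) (y : P ⟶ C),
    S.projectives P ∧ S.IsConflation x y

/-- Every object is the first term of a conflation with injective middle term. -/
class EnoughInjectives : Prop where
  exists_conflation : ∀ A : B, ∃ (I C : B) (x : A ⟶ I) (y : I ⟶ C),
    S.injectives I ∧ S.IsConflation x y

/-- The objects `X` with an `E`-triangle `C ⟶ D ⟶ X`, `C` in `𝒞` and `D` in `𝒟`. -/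
def Cone (𝒞 𝒟 : ObjectProperty B) : ObjectProperty B := fun X =>
  ∃ (C D : B) (x : C ⟶ D) (y : D ⟶ X), 𝒞 C ∧ 𝒟 D ∧ S.IsConflation x y

/-- The objects `X` with an `E`-triangle `X ⟶ C ⟶ D`, `C` in `𝒞` and `D` in `𝒟`. -/
def CoCone (𝒞 𝒟 : ObjectProperty B) : ObjectProperty B := fun X =>
  ∃ (C D : B) (x : X ⟶ C) (y : C ⟶ D), 𝒞 C ∧ 𝒟 D ∧ S.IsConflation x y

/-- The class `𝒞^∧_n`. -/
def wedge (𝒞 : ObjectProperty B) : ℕ → ObjectProperty B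
  | 0 => 𝒞
  | n + 1 => S.Cone (wedge 𝒞 n) 𝒞

/-- The class `𝒞^∨_n`. -/
def vee (𝒞 : ObjectProperty B) : ℕ → ObjectProperty B
  | 0 => 𝒞
  | n + 1 => S.CoCone 𝒞 (vee 𝒞 n)

/-- A chosen syzygy `ΩX`, sitting in an `E`-triangle `ΩX ⟶ P ⟶ X` with `P` projective. -/
noncomputable def syzygy [S.EnoughProjectives] (X : B) : B :=
  (EnoughProjectives.exists_conflation (S := S) X).choose

/-- The iterated syzygy `Ωⁿ X`. -/
noncomputable def iterSyzygy [S.EnoughProjectives] : ℕ → B → B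
  | 0, X => X
  | n + 1, X => S.syzygy (iterSyzygy n X)

/-- The higher extension group `Eⁿ(X, Y) = E(Ωⁿ⁻¹ X, Y)` for `n ≥ 1`; the value at `n = 0` is
not used. -/
noncomputable abbrev higherExt [S.EnoughProjectives] (n : ℕ) (X Y : B) : Type w :=
  Extn S.E (S.iterSyzygy (n - 1) X) Y

/-- The projective dimension of an object. -/
noncomputable def pd [S.EnoughProjectives] (X : B) : ℕ∞ :=
  ⨆ n ∈ {n : ℕ | 1 ≤ n ∧ ∃ Y : B, Nontrivial (S.higherExt n X Y)}, (n : ℕ∞)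

/-- The injective dimension of an object. -/
noncomputable def injd [S.EnoughProjectives] (Y : B) : ℕ∞ :=
  ⨆ n ∈ {n : ℕ | 1 ≤ n ∧ ∃ X : B, Nontrivial (S.higherExt n X Y)}, (n : ℕ∞)

/-- The projective dimension of a class of objects. -/
noncomputable def pdClass [S.EnoughProjectives] (𝒞 : ObjectProperty B) : ℕ∞ :=
  ⨆ (X : B) (_ : 𝒞 X), S.pd X

/-- The injective dimension of a class of objects. -/
noncomputable def injdClass [S.EnoughProjectives] (𝒞 : ObjectProperty B) : ℕ∞ :=
  ⨆ (X : B) (_ : 𝒞 X), S.injd X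

/-- `T` is an `n`-tilting subcategory (`n ≥ 1`). -/
structure IsNTilting [S.EnoughProjectives] (n : ℕ) (T : ObjectProperty B) : Prop where
  subcategory : IsAdditiveSubcategory T
  one_le : 1 ≤ n
  pd_le : S.pdClass T ≤ n
  ext_eq_zero : ∀ i : ℕ, 1 ≤ i → i ≤ n → ∀ X Y : B, T X → T Y → Subsingleton (S.higherExt i X Y)
  projectives_le : S.projectives ≤ S.vee T n

/-- `T` is an `n`-cotilting subcategory (`n ≥ 1`). -/
structure IsNCotilting [S.EnoughProjectives] (n : ℕ) (T : ObjectProperty B) : Prop where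
  subcategory : IsAdditiveSubcategory T
  one_le : 1 ≤ n
  injd_le : S.injdClass T ≤ n
  ext_eq_zero : ∀ i : ℕ, 1 ≤ i → i ≤ n → ∀ X Y : B, T X → T Y → Subsingleton (S.higherExt i X Y)
  injectives_le : S.injectives ≤ S.wedge T n

def IsTilting [S.EnoughProjectives] (T : ObjectProperty B) : Prop :=
  ∃ n : ℕ, S.IsNTilting n T

def IsCotilting [S.EnoughProjectives] (T : ObjectProperty B) : Prop :=
  ∃ n : ℕ, S.IsNCotilting n T

/-- The extriangulated category is Gorenstein. -/
def IsGorenstein [S.EnoughProjectives] : Prop :=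
  S.pdClass S.injectives < ⊤ ∧ S.injdClass S.projectives < ⊤

/-- The extriangulated category is an abelian category: the underlying category is abelian, and
the `E`-triangles are its short exact sequences. -/
structure IsAbelianCategory : Prop where
  hasKernels : HasKernels B
  hasCokernels : HasCokernels B
  normalMono : IsNormalMonoCategory B
  normalEpi : IsNormalEpiCategory B
  conflation_iff : ∀ {A X C : B} (x : A ⟶ X) (y : X ⟶ C),
    S.IsConflation x y ↔ ∃ h : x ≫ y = 0, (ShortComplex.mk x y h).ShortExact

/-- Condition (AF). -/
def AF : Prop :=
  S.IsAbelianCategory ∨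
    (IsCovariantlyFinite S.projectives ∧ IsContravariantlyFinite S.injectives)

end

end Extriangulation

/-! The projectives form a tilting subcategory and the injectives a cotilting one, so (2) and (3)
each imply (4). For (4) ⇒ (1), a projective has a finite coresolution by `T` and `id T` is finite;
each step of the coresolution raises the injective dimension by at most one (`idLE_of_vee`). The
bound for injectives is dual.

For (1) ⇒ (2), objects of a tilting `T` have finite projective resolutions, and passing to the right
end of a conflation does not raise a bound on injective dimension (`idLE_of_wedge`), so `id T` is
finite. An injective `I` has a finite projective resolution, which gives an Auslander–Buchweitz
conflation `Y ⟶ Z ⟶ I` with `Y` in `T^∧` and `Z` in `T^∨` (`exists_approximations`). Since `E(T^∨,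
Y) = 0 = E(T^∨, I)`, also `E(T^∨, Z) = 0`; the first conflation coresolving `Z` splits, so `Z` lies
in `T` and `I` in `T^∧` (`wedge_of_inj`).

Only the existence of conflations between given objects and the vanishing of extension groups
matter. Both are recorded in a self-dual structure, so that (1) ⇒ (3) is (1) ⇒ (2) in the dual. -/

/-- The formal properties of conflations and of the vanishing of higher extension groups in an
extriangulated category with enough projectives and enough injectives which are used in the
comparison of tilting and cotilting subcategories. The list of axioms is self-dual. -/
structure ConflationCalculus (B : Type u) where
  /-- there is a conflation `A ⟶ X ⟶ Z` -/
  Conf : B → B → B → Prop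
  /-- the extension group of degree `i + 1` of `X` by `Y` vanishes -/
  Vanish : ℕ → B → B → Prop
  /-- a zero object -/
  zero : B
  conf_zero_right : ∀ X, Conf X X zero
  conf_zero_left : ∀ X, Conf zero X X
  pushout : ∀ {A X Z Y W}, Conf A X Z → Conf A Y W → ∃ M, Conf Y M Z ∧ Conf X M W
  pullback : ∀ {A X Z Y W}, Conf Z X A → Conf W Y A → ∃ M, Conf Z M Y ∧ Conf W M X
  comp : ∀ {A X D Y F}, Conf A X D → Conf X Y F → ∃ Z, Conf A Y Z ∧ Conf D Z F
  comp_op : ∀ {A X D Y F}, Conf D X A → Conf F Y X → ∃ Z, Conf Z Y A ∧ Conf F Z D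
  split_extend : ∀ {A X Z D F}, Conf A X Z → Vanish 0 Z A → Conf Z D F →
    ∃ Y, Conf A Y D ∧ Conf X Y F
  split_lift : ∀ {A X Z D F}, Conf Z X A → Vanish 0 A Z → Conf F D Z →
    ∃ Y, Conf D Y A ∧ Conf F Y X
  vanish_zero_mid : ∀ {A X Z} (W), Conf A X Z → Vanish 0 W A → Vanish 0 W Z → Vanish 0 W X
  vanish_zero_mid_op : ∀ {A X Z} (W), Conf Z X A → Vanish 0 A W → Vanish 0 Z W → Vanish 0 X W
  vanish_zero_split : ∀ {A X Z} (W), Conf A X Z → Vanish 0 Z A → Vanish 0 W X → Vanish 0 W Z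
  vanish_zero_split_op : ∀ {A X Z} (W), Conf Z X A → Vanish 0 A Z → Vanish 0 X W → Vanish 0 Z W
  enough_proj : ∀ X, ∃ A P, (∀ Y, Vanish 0 P Y) ∧ Conf A P X
  enough_inj : ∀ X, ∃ A I, (∀ Y, Vanish 0 Y I) ∧ Conf X I A
  shift_proj : ∀ {A P X} (i Y), (∀ Y, Vanish 0 P Y) → Conf A P X →
    (Vanish i A Y ↔ Vanish (i + 1) X Y)
  shift_inj : ∀ {A I X} (i Y), (∀ Y, Vanish 0 Y I) → Conf X I A →
    (Vanish i Y A ↔ Vanish (i + 1) Y X)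

namespace ConflationCalculus

/-- The dual calculus. -/
def op {B : Type u} (C : ConflationCalculus B) : ConflationCalculus B where
  Conf A X Z := C.Conf Z X A
  Vanish i X Y := C.Vanish i Y X
  zero := C.zero
  conf_zero_right := C.conf_zero_left
  conf_zero_left := C.conf_zero_right
  pushout := C.pullback
  pullback := C.pushout
  comp := C.comp_op
  comp_op := C.comp
  split_extend := C.split_lift
  split_lift := C.split_extend
  vanish_zero_mid := C.vanish_zero_mid_op
  vanish_zero_mid_op := C.vanish_zero_mid
  vanish_zero_split := C.vanish_zero_split_op
  vanish_zero_split_op := C.vanish_zero_split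
  enough_proj := C.enough_inj
  enough_inj := C.enough_proj
  shift_proj := C.shift_inj
  shift_inj := C.shift_proj

section

variable {B : Type u} (C : ConflationCalculus B)

/-- Projective objects. -/
def Proj (P : B) : Prop := ∀ Y, C.Vanish 0 P Y

/-- Injective objects. -/
def Inj (I : B) : Prop := ∀ X, C.Vanish 0 X I

/-- The projective dimension of `X` is at most `n`. -/
def PdLE (n : ℕ) (X : B) : Prop := ∀ i, n ≤ i → ∀ Y, C.Vanish i X Y

/-- The injective dimension of `X` is at most `n`. -/
def IdLE (n : ℕ) (X : B) : Prop := ∀ i, n ≤ i → ∀ Y, C.Vanish i Y X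

/-- The objects with a `T`-coresolution of length `n`. -/
def Vee (T : B → Prop) : ℕ → B → Prop
  | 0 => T
  | n + 1 => fun X => ∃ Y Z, T Y ∧ Vee T n Z ∧ C.Conf X Y Z

/-- The objects with a `T`-resolution of length `n`. -/
def Wedge (T : B → Prop) : ℕ → B → Prop := C.op.Vee T

/-- A class of objects containing the zero object and compatible with split conflations. -/
structure SplitClosed (T : B → Prop) : Prop where
  zero : T C.zero
  mid : ∀ {A X Z}, C.Conf A X Z → C.Vanish 0 Z A → T A → T Z → T X
  left : ∀ {A X Z}, C.Conf A X Z → C.Vanish 0 Z A → T X → T A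
  right : ∀ {A X Z}, C.Conf A X Z → C.Vanish 0 Z A → T X → T Z

/-- A tilting class. -/
structure Tilting (T : B → Prop) : Prop where
  vanish : ∀ {X Y}, T X → T Y → ∀ i, C.Vanish i X Y
  exists_bound : ∃ n, (∀ X, T X → C.PdLE n X) ∧ ∀ P, C.Proj P → C.Vee T n P

end

/-! ### Dimension bounds, resolutions and approximations in the calculus -/

section

variable {B : Type u} {C : ConflationCalculus B} {T : B → Prop}

theorem SplitClosed.op (hT : C.SplitClosed T) : C.op.SplitClosed T where
  zero := hT.zero
  mid h v a z := hT.mid h v z a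
  left := hT.right
  right := hT.left

/-- Shifting through cosyzygies of `Y` keeps `P` fixed, so the induction returns to degree zero on
`P` itself. -/
theorem Proj.vanish {P : B} (hP : C.Proj P) (i : ℕ) (Y : B) : C.Vanish i P Y := by
  induction i generalizing Y with
  | zero => exact hP Y
  | succ i ih =>
    obtain ⟨Z, I, hI, h⟩ := C.enough_inj Y
    exact (C.shift_inj i P hI h).1 (ih Z)

theorem vanish_mid {A X Z : B} (h : C.Conf A X Z) {i : ℕ} {W : B} (hA : C.Vanish i W A)
    (hZ : C.Vanish i W Z) : C.Vanish i W X := by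
  induction i generalizing W with
  | zero => exact C.vanish_zero_mid W h hA hZ
  | succ i ih =>
    obtain ⟨K, P, hP, hK⟩ := C.enough_proj W
    rw [← C.shift_proj i _ hP hK] at hA hZ ⊢
    exact ih hA hZ

theorem vanish_split {A X Z : B} (h : C.Conf A X Z) (hs : C.Vanish 0 Z A) {i : ℕ} {W : B}
    (hX : C.Vanish i W X) : C.Vanish i W Z := by
  induction i generalizing W with
  | zero => exact C.vanish_zero_split W h hs hX
  | succ i ih =>
    obtain ⟨K, P, hP, hK⟩ := C.enough_proj W
    rw [← C.shift_proj i _ hP hK] at hX ⊢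
    exact ih hX

/-- Rotation of a triangle: since `I` is injective, `I ⟶ M ⟶ Z` splits and `M` is `I ⊕ Z`. This
substitutes for the long exact sequence. -/
theorem exists_rotation {A X Z : B} (h : C.Conf A X Z) :
    ∃ A' I M, C.Inj I ∧ C.Conf A I A' ∧ C.Conf I M Z ∧ C.Conf X M A' := by
  obtain ⟨A', I, hI, hA⟩ := C.enough_inj A
  obtain ⟨M, h₁, h₂⟩ := C.pushout h hA
  exact ⟨A', I, M, hI, hA, h₁, h₂⟩

/-- In the rotated conflation `X ⟶ M ⟶ A'`, the vanishing for `A` shifts down to `A'`; `M` inherits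
it as an extension, and `Z` as a summand of `M`. -/
theorem vanish_right {A X Z : B} (h : C.Conf A X Z) {i : ℕ} {W : B} (hX : C.Vanish i W X)
    (hA : C.Vanish (i + 1) W A) : C.Vanish i W Z := by
  obtain ⟨A', I, M, hI, hA', h₁, h₂⟩ := exists_rotation h
  exact vanish_split h₁ (hI Z) (vanish_mid h₂ hX ((C.shift_inj i W hI hA').2 hA))

theorem vanish_left {A X Z : B} (h : C.Conf A X Z) {i : ℕ} {W : B} (hZ : C.Vanish i W Z)
    (hX : C.Vanish (i + 1) W X) : C.Vanish (i + 1) W A := by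
  obtain ⟨A', I, M, hI, hA', h₁, h₂⟩ := exists_rotation h
  exact (C.shift_inj i W hI hA').1
    (vanish_right h₂ (vanish_mid h₁ (Proj.vanish (C := C.op) hI i W) hZ) hX)

theorem vee_succ (hT : C.SplitClosed T) {n : ℕ} {X : B} (h : C.Vee T n X) :
    C.Vee T (n + 1) X := by
  induction n generalizing X with
  | zero => exact ⟨X, C.zero, h, hT.zero, C.conf_zero_right X⟩
  | succ n ih =>
    obtain ⟨Y, Z, hY, hZ, hX⟩ := h
    exact ⟨Y, Z, hY, ih hZ, hX⟩

theorem vee_mono (hT : C.SplitClosed T) {n m : ℕ} (hnm : n ≤ m) {X : B} (h : C.Vee T n X) :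
    C.Vee T m X := by
  induction hnm with
  | refl => exact h
  | step _ ih => exact vee_succ hT ih

/-- Each step asks for vanishing one degree higher on the cokernel, hence the hypothesis in all
degrees. -/
theorem vanish_of_vee {Y : B} (hY : ∀ X, T X → ∀ i, C.Vanish i X Y) {n : ℕ} {X : B}
    (h : C.Vee T n X) (i : ℕ) : C.Vanish i X Y := by
  induction n generalizing X i with
  | zero => exact hY X h i
  | succ n ih =>
    obtain ⟨Y', Z, hY', hZ, hX⟩ := h
    exact vanish_right (C := C.op) hX (hY Y' hY' i) (ih hZ (i + 1))

theorem idLE_of_vee {m : ℕ} (hT : ∀ X, T X → C.IdLE m X) {n : ℕ} {X : B} (h : C.Vee T n X) :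
    C.IdLE (m + n) X := by
  induction n generalizing X with
  | zero => exact hT X h
  | succ n ih =>
    obtain ⟨Y, Z, hY, hZ, hX⟩ := h
    intro i hi W
    obtain ⟨i, rfl⟩ : ∃ j, i = j + 1 := ⟨i - 1, by omega⟩
    exact vanish_left hX (ih hZ i (by omega) W) (hT Y hY (i + 1) (by omega) W)

theorem idLE_of_wedge {m : ℕ} (hT : ∀ X, T X → C.IdLE m X) {n : ℕ} {X : B}
    (h : C.Wedge T n X) : C.IdLE m X := by
  induction n generalizing X with
  | zero => exact hT X h
  | succ n ih =>
    obtain ⟨Y, Z, hY, hZ, hX⟩ := h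
    intro i hi W
    exact vanish_right (C := C) hX (hT Y hY i hi W) (ih hZ (i + 1) (by omega) W)

theorem PdLE.wedge {n : ℕ} {X : B} (h : C.PdLE n X) : C.Wedge C.Proj n X := by
  induction n generalizing X with
  | zero => exact h 0 le_rfl
  | succ n ih =>
    obtain ⟨A, P, hP, hX⟩ := C.enough_proj X
    exact ⟨P, A, hP, ih fun i hi Y => (C.shift_proj i Y hP hX).2 (h (i + 1) (by omega) Y), hX⟩

/-- The objects with a finite coresolution by a self-orthogonal class are closed under
extensions. -/
theorem vee_mid (hT : C.SplitClosed T) (hV : ∀ X Y, T X → T Y → ∀ i, C.Vanish i X Y) {n : ℕ}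
    {A X Z : B} (h : C.Conf A X Z) (hA : C.Vee T n A) (hZ : C.Vee T n Z) : C.Vee T n X := by
  induction n generalizing A X Z with
  | zero => exact hT.mid h (hV Z A hZ hA 0) hA hZ
  | succ n ih =>
    have hZ' := hZ
    obtain ⟨TA, A', hTA, hA', hcA⟩ := hA
    obtain ⟨TZ, Z', hTZ, hZ', hcZ⟩ := hZ
    -- Horseshoe: `E(Z, TA) = 0` splits `TA ⟶ M ⟶ Z`, so `M` embeds in `Y = TA ⊕ TZ` with cokernel
    -- `Z'`. The composite `X ⟶ M ⟶ Y` then has as cokernel an extension of `Z'` by `A'`.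
    obtain ⟨M, hM, hM'⟩ := C.pushout h hcA
    obtain ⟨Y, hY, hY'⟩ :=
      C.split_extend hM (vanish_of_vee (fun X hX => hV X TA hX hTA) ‹C.Vee T (n + 1) Z› 0) hcZ
    obtain ⟨F, hF, hF'⟩ := C.comp hM' hY'
    exact ⟨Y, F, hT.mid hY (hV TZ TA hTZ hTA 0) hTA hTZ, ih hF' hA' hZ', hF⟩

/-- The two approximation sequences of Auslander and Buchweitz. -/
theorem exists_approximations (hT : C.SplitClosed T)
    (hV : ∀ X Y, T X → T Y → ∀ i, C.Vanish i X Y) {n : ℕ}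
    (hP : ∀ P, C.Proj P → C.Vee T n P) {m : ℕ} {X : B} (h : C.Wedge C.Proj (m + 1) X) :
    (∃ N Y Z, C.Wedge T m Y ∧ C.Vee T N Z ∧ C.Conf Y Z X) ∧
      ∃ N Y Z, C.Wedge T (m + 1) Y ∧ C.Vee T N Z ∧ C.Conf X Y Z := by
  -- Pushing `P` out along `K ⟶ Y` gives `Y ⟶ M ⟶ X` with `M` an extension of `Z` by `P`, hence in
  -- `T^∨`. Composing with `M ⟶ T₀` turns this into the second sequence, which feeds the induction.
  have key : ∀ {m : ℕ} {K P X : B}, C.Conf K P X → C.Proj P →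
      (∃ N Y Z, C.Wedge T m Y ∧ C.Vee T N Z ∧ C.Conf K Y Z) →
      (∃ N Y Z, C.Wedge T m Y ∧ C.Vee T N Z ∧ C.Conf Y Z X) ∧
        ∃ N Y Z, C.Wedge T (m + 1) Y ∧ C.Vee T N Z ∧ C.Conf X Y Z := by
    rintro m K P X hX hPP ⟨N, Y, Z, hY, hZ, hK⟩
    obtain ⟨M, hM, hM'⟩ := C.pushout hX hK
    -- The extra `+ 1` guarantees a first coresolution step `M ⟶ T₀ ⟶ M'`.
    have hMV : C.Vee T (max n N + 1) M := vee_succ hT (vee_mid hT hV hM'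
      (vee_mono hT (le_max_left n N) (hP P hPP)) (vee_mono hT (le_max_right n N) hZ))
    refine ⟨⟨_, Y, M, hY, hMV, hM⟩, ?_⟩
    obtain ⟨T₀, M', hT₀, hM₁, hM₂⟩ := hMV
    obtain ⟨F, hF, hF'⟩ := C.comp hM hM₂
    exact ⟨_, F, M', ⟨T₀, Y, hT₀, hY, hF⟩, hM₁, hF'⟩
  induction m generalizing X with
  | zero =>
    obtain ⟨P, K, hPP, hK, hX⟩ := h
    obtain ⟨T₀, D, hT₀, hD, hK'⟩ := vee_succ hT (hP K hK)
    exact key hX hPP ⟨n, T₀, D, hT₀, hD, hK'⟩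
  | succ m ih =>
    obtain ⟨P, K, hPP, hK, hX⟩ := h
    exact key hX hPP (ih hK).2

/-- Injectivity relative to `T^∨` splits the first conflation of the coresolution, making `X` a
summand of an object of `T`. -/
theorem mem_of_vee_of_inj (hT : C.SplitClosed T) {n : ℕ} {X : B} (h : C.Vee T n X)
    (hX : ∀ (N : ℕ) (Z : B), C.Vee T N Z → C.Vanish 0 Z X) : T X := by
  cases n with
  | zero => exact h
  | succ n =>
    obtain ⟨Y, Z, hY, hZ, hc⟩ := h
    exact hT.left hc (hX n Z hZ) hY

theorem wedge_of_inj (hT : C.SplitClosed T) (hV : ∀ X Y, T X → T Y → ∀ i, C.Vanish i X Y)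
    {n : ℕ} (hP : ∀ P, C.Proj P → C.Vee T n P) {m : ℕ} {I : B} (hI : C.Inj I)
    (h : C.Wedge C.Proj (m + 1) I) : C.Wedge T (m + 1) I := by
  obtain ⟨N, Y, Z, hY, hZ, hc⟩ := (exists_approximations hT hV hP h).1
  refine ⟨Z, Y, mem_of_vee_of_inj hT hZ fun N' W hW => ?_, hY, hc⟩
  refine vanish_mid hc ?_ (hI W)
  -- `E(T^∨, T^∧) = 0`: orthogonality is extended along the coresolution of `W`, then dually along
  -- the resolution of `Y`.
  exact vanish_of_vee (C := C.op) (T := T)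
    (fun U hU i => vanish_of_vee (fun X hX => hV X U hX hU) hW i) hY 0

theorem Tilting.cotilting (hT : C.SplitClosed T) (h : C.Tilting T)
    (hI : ∃ n, ∀ I, C.Inj I → C.PdLE n I) (hP : ∃ n, ∀ P, C.Proj P → C.IdLE n P) :
    C.op.Tilting T := by
  obtain ⟨n, hn, hvee⟩ := h.exists_bound
  obtain ⟨a, ha⟩ := hI
  obtain ⟨b, hb⟩ := hP
  -- `b` bounds `id T`; `a + 1` is a resolution length for injectives, nonzero as `wedge_of_inj`
  -- requires.
  refine ⟨fun hX hY i => h.vanish hY hX i, max (a + 1) b, fun X hX i hi Y => ?_, fun I hI => ?_⟩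
  · exact idLE_of_wedge hb (hn X hX).wedge i (by omega) Y
  · exact vee_mono hT.op (le_max_left _ _) (wedge_of_inj hT (fun X Y hX hY => h.vanish hX hY)
      hvee hI (PdLE.wedge fun i hi => ha I hI i (by omega)))

theorem Tilting.exists_idLE (h : C.Tilting T) (h' : C.op.Tilting T) :
    ∃ n, ∀ P, C.Proj P → C.IdLE n P := by
  obtain ⟨n, -, hvee⟩ := h.exists_bound
  obtain ⟨m, hm, -⟩ := h'.exists_bound
  exact ⟨m + n, fun P hP => idLE_of_vee hm (hvee P hP)⟩

theorem tilting_proj (C : ConflationCalculus B) : C.Tilting C.Proj where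
  vanish hX _ i := hX.vanish i _
  exists_bound := ⟨0, fun _ hX i _ Y => hX.vanish i Y, fun _ hP => hP⟩

end

end ConflationCalculus

/-! ### Functoriality of extensions -/

namespace Extn

section

variable {B : Type u} [Category.{v} B] {E : Bᵒᵖ ⥤ B ⥤ AddCommGrpCat.{w}}

@[simp]
theorem push_id {C A : B} (δ : Extn E C A) : push (𝟙 A) δ = δ := by
  simp [push]

@[simp]
theorem pull_id {C A : B} (δ : Extn E C A) : pull (𝟙 C) δ = δ := by
  simp [pull]

theorem push_comp {C A A' A'' : B} (a : A ⟶ A') (a' : A' ⟶ A'') (δ : Extn E C A) :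
    push (a ≫ a') δ = push a' (push a δ) := by
  simp [push]

theorem pull_comp {C C' C'' A : B} (c : C' ⟶ C) (c' : C'' ⟶ C') (δ : Extn E C A) :
    pull (c' ≫ c) δ = pull c' (pull c δ) := by
  simp [pull]

theorem push_pull {C C' A A' : B} (a : A ⟶ A') (c : C' ⟶ C) (δ : Extn E C A) :
    push a (pull c δ) = pull c (push a δ) := by
  have := (E.map c.op).naturality a
  exact (congrArg (fun f => f.hom δ) this).symm

@[simp]
theorem push_zero {C A A' : B} (a : A ⟶ A') : push a (0 : Extn E C A) = 0 :=
  map_zero _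

@[simp]
theorem pull_zero {C C' A : B} (c : C' ⟶ C) : pull c (0 : Extn E C A) = 0 :=
  map_zero _

theorem push_add {C A A' : B} (a : A ⟶ A') (δ δ' : Extn E C A) :
    push a (δ + δ') = push a δ + push a δ' :=
  map_add _ _ _

theorem pull_add {C C' A : B} (c : C' ⟶ C) (δ δ' : Extn E C A) :
    pull c (δ + δ') = pull c δ + pull c δ' :=
  map_add _ _ _

theorem subsingleton_of_retract_right {C A A' : B} (i : A ⟶ A') (r : A' ⟶ A) (h : i ≫ r = 𝟙 A)
    (hA' : Subsingleton (Extn E C A')) : Subsingleton (Extn E C A) := by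
  refine subsingleton_of_forall_eq 0 fun δ => ?_
  rw [← push_id δ, ← h, push_comp, Subsingleton.elim (push i δ) 0, push_zero]

theorem subsingleton_of_retract_left {C C' A : B} (i : C ⟶ C') (r : C' ⟶ C) (h : i ≫ r = 𝟙 C)
    (hC' : Subsingleton (Extn E C' A)) : Subsingleton (Extn E C A) := by
  refine subsingleton_of_forall_eq 0 fun δ => ?_
  rw [← pull_id δ, ← h, pull_comp, Subsingleton.elim (pull r δ) 0, pull_zero]

end

end Extn

/-! ### Exactness properties of triangles -/

namespace Extriangulation

section

variable {B : Type u} [Category.{v} B] [Preadditive B] [HasBinaryBiproducts B]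
  (S : Extriangulation.{w} B)

theorem zero_push {C A A' : B} (δ : Extn S.E C A) : Extn.push (0 : A ⟶ A') δ = 0 := by
  have := S.additive_right (op C)
  simp [Extn.push]

theorem zero_pull {C C' A : B} (δ : Extn S.E C A) : Extn.pull (0 : C' ⟶ C) δ = 0 := by
  have := S.additive_left
  simp [Extn.pull]

variable {S}

section

variable {A X C : B} {x : A ⟶ X} {y : X ⟶ C} {δ : Extn S.E C A}

theorem IsTriangle.of_iso (h : S.IsTriangle x y δ) {X' : B} (b : X ≅ X') :
    S.IsTriangle (x ≫ b.hom) (b.inv ≫ y) δ :=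
  (S.triangle_iff h _ _).2 ⟨b, rfl, by simp⟩

variable [HasZeroObject B]

open ZeroObject

variable (S) in
theorem triangle_id_left (X : B) : S.IsTriangle (𝟙 X) (0 : X ⟶ 0) (0 : Extn S.E 0 X) :=
  (S.triangle_iff (S.triangle_zero X 0) _ _).2
    ⟨⟨biprod.fst, biprod.inl, by ext; simp, by simp⟩, by simp, by ext⟩

variable (S) in
theorem triangle_id_right (X : B) : S.IsTriangle (0 : 0 ⟶ X) (𝟙 X) (0 : Extn S.E X 0) :=
  (S.triangle_iff (S.triangle_zero 0 X) _ _).2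
    ⟨⟨biprod.snd, biprod.inr, by ext; simp, by simp⟩, by ext, by simp⟩

/-- The trivial triangle `0 ⟶ X ⟶ X` maps to the given one, so `y^* δ` is pushed forward from a zero
extension. -/
theorem IsTriangle.pull_eq_zero (h : S.IsTriangle x y δ) : Extn.pull y δ = 0 := by
  obtain ⟨a, -, ha⟩ := S.et3_op (S.triangle_id_right X) h (𝟙 X) y rfl
  rw [← ha, Extn.push_zero]

theorem IsTriangle.push_eq_zero (h : S.IsTriangle x y δ) : Extn.push x δ = 0 := by
  obtain ⟨c, -, hc⟩ := S.et3 h (S.triangle_id_left X) x (𝟙 X) rfl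
  rw [hc, Extn.pull_zero]

theorem IsTriangle.exists_lift_iff (h : S.IsTriangle x y δ) {W : B} (c : W ⟶ C) :
    (∃ b, b ≫ y = c) ↔ Extn.pull c δ = 0 := by
  constructor
  · rintro ⟨b, rfl⟩
    rw [Extn.pull_comp, h.pull_eq_zero, Extn.pull_zero]
  · intro hc
    -- The split triangle realizes `c^* δ = 0`; the lift is the restriction to `W` of the induced
    -- map on `A ⊞ W`.
    obtain ⟨b, -, hb⟩ := S.realize (S.triangle_zero A W) h (𝟙 A) c (by simp [hc])
    exact ⟨biprod.inr ≫ b, by rw [Category.assoc, ← hb]; simp⟩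

theorem IsTriangle.exists_desc_iff (h : S.IsTriangle x y δ) {W : B} (a : A ⟶ W) :
    (∃ b, x ≫ b = a) ↔ Extn.push a δ = 0 := by
  constructor
  · rintro ⟨b, rfl⟩
    rw [Extn.push_comp, h.push_eq_zero, Extn.push_zero]
  · intro ha
    obtain ⟨b, hb, -⟩ := S.realize h (S.triangle_zero W C) a (𝟙 C) (by simp [ha])
    exact ⟨b ≫ biprod.fst, by rw [← Category.assoc, hb]; simp⟩

theorem IsTriangle.exists_lift_left (h : S.IsTriangle x y δ) {W : B} (f : W ⟶ X)
    (hf : f ≫ y = 0) : ∃ g, g ≫ x = f := by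
  obtain ⟨a, ha, -⟩ := S.et3_op (S.triangle_id_left W) h f 0 (by simp [hf])
  exact ⟨a, by simpa using ha.symm⟩

theorem IsTriangle.exists_desc_right (h : S.IsTriangle x y δ) {W : B} (f : X ⟶ W)
    (hf : x ≫ f = 0) : ∃ g, y ≫ g = f := by
  obtain ⟨c, hc, -⟩ := S.et3 h (S.triangle_id_right W) 0 f (by simp [hf])
  exact ⟨c, by simpa using hc⟩

theorem IsTriangle.exists_pull_eq (h : S.IsTriangle x y δ) {W : B} (θ : Extn S.E W A)
    (hθ : Extn.push x θ = 0) : ∃ c, Extn.pull c δ = θ := by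
  obtain ⟨N, n, n', hN⟩ := S.exists_triangle θ
  obtain ⟨g, hg⟩ := (hN.exists_desc_iff x).2 hθ
  obtain ⟨c, -, hc⟩ := S.et3 hN h (𝟙 A) g (by simp [hg])
  exact ⟨c, by simpa using hc.symm⟩

theorem IsTriangle.exists_push_eq (h : S.IsTriangle x y δ) {W : B} (θ : Extn S.E C W)
    (hθ : Extn.pull y θ = 0) : ∃ a, Extn.push a δ = θ := by
  obtain ⟨N, n, n', hN⟩ := S.exists_triangle θ
  obtain ⟨g, hg⟩ := (hN.exists_lift_iff y).2 hθ
  obtain ⟨a, -, ha⟩ := S.et3_op h hN g (𝟙 C) (by simp [hg])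
  exact ⟨a, by simpa using ha⟩

/-- A morphism of triangles whose end components are isomorphisms is an isomorphism. -/
theorem IsTriangle.isIso_mid (h : S.IsTriangle x y δ) {A' X' C' : B} {x' : A' ⟶ X'}
    {y' : X' ⟶ C'} {δ' : Extn S.E C' A'} (h' : S.IsTriangle x' y' δ') (a : A ≅ A') (c : C ≅ C')
    (hac : Extn.push a.hom δ = Extn.pull c.hom δ') {b : X ⟶ X'} (hx : x ≫ b = a.hom ≫ x')
    (hy : y ≫ c.hom = b ≫ y') : IsIso b := by
  have hac' : Extn.pull c.inv δ = Extn.push a.inv δ' := by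
    rw [← Extn.push_id δ, ← a.hom_inv_id, Extn.push_comp, hac, Extn.push_pull, ← Extn.pull_comp]
    simp
  obtain ⟨s, hs⟩ : ∃ s, s ≫ b = 𝟙 X' := by
    obtain ⟨u, hu⟩ := (h.exists_lift_iff (y' ≫ c.inv)).2 (by
      rw [Extn.pull_comp, hac', ← Extn.push_pull, h'.pull_eq_zero, Extn.push_zero])
    -- `u` is a section only modulo `y'`; the defect factors through `x'` and is corrected by `g`.
    obtain ⟨g, hg⟩ := h'.exists_lift_left (𝟙 X' - u ≫ b) (by
      rw [Preadditive.sub_comp, Category.assoc, ← hy, reassoc_of% hu]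
      simp)
    exact ⟨u + g ≫ a.inv ≫ x, by simp [hx, hg]⟩
  obtain ⟨r, hr⟩ : ∃ r, b ≫ r = 𝟙 X := by
    obtain ⟨u, hu⟩ := (h'.exists_desc_iff (a.inv ≫ x)).2 (by
      rw [Extn.push_comp, ← hac', Extn.push_pull, h.push_eq_zero, Extn.pull_zero])
    obtain ⟨g, hg⟩ := h.exists_desc_right (𝟙 X - b ≫ u) (by
      rw [Preadditive.comp_sub, reassoc_of% hx, hu]
      simp)
    exact ⟨u + y' ≫ c.inv ≫ g, by simp [← reassoc_of% hy, hg]⟩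
  have : s = r := by rw [← Category.comp_id s, ← hr, reassoc_of% hs]
  exact ⟨r, hr, this ▸ hs⟩

theorem IsTriangle.subsingleton_mid_right (h : S.IsTriangle x y δ) {W : B}
    (hA : Subsingleton (Extn S.E W A)) (hC : Subsingleton (Extn S.E W C)) :
    Subsingleton (Extn S.E W X) := by
  refine subsingleton_of_forall_eq 0 fun θ => ?_
  obtain ⟨N, n, n', hN⟩ := S.exists_triangle θ
  -- (ET4) makes `e` the deflation of a triangle with extension `y_* θ`, zero by `hC`. A section `s`
  -- of `e` gives `θ = s^* e^* θ = x_* s^* δ''`, which vanishes by `hA`.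
  obtain ⟨Z, h', d, e, δ'', -, -, -, hde, -, hpe⟩ := S.et4 h hN
  obtain ⟨s, hs⟩ := (hde.exists_lift_iff (𝟙 W)).2 (Subsingleton.elim _ _)
  rw [← Extn.pull_id θ, ← hs, Extn.pull_comp, ← hpe, ← Extn.push_pull,
    Subsingleton.elim (Extn.pull s δ'') 0, Extn.push_zero]

theorem IsTriangle.subsingleton_mid_left (h : S.IsTriangle x y δ) {W : B}
    (hA : Subsingleton (Extn S.E A W)) (hC : Subsingleton (Extn S.E C W)) :
    Subsingleton (Extn S.E X W) := by
  refine subsingleton_of_forall_eq 0 fun θ => ?_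
  obtain ⟨N, n, n', hN⟩ := S.exists_triangle θ
  obtain ⟨Z, d, e, h', δ'', -, -, -, hde, -, hpe⟩ := S.et4_op hN h
  obtain ⟨r, hr⟩ := (hde.exists_desc_iff (𝟙 W)).2 (Subsingleton.elim _ _)
  rw [← Extn.push_id θ, ← hr, Extn.push_comp, hpe, Extn.push_pull,
    Subsingleton.elim (Extn.push r δ'') 0, Extn.pull_zero]

end

/-! ### Conflations with prescribed terms -/

variable (S)

/-- Existence of a conflation with prescribed terms. -/
def ConfObj (A X C : B) : Prop := ∃ (x : A ⟶ X) (y : X ⟶ C), S.IsConflation x y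

variable {S}

theorem IsTriangle.confObj {A X C : B} {x : A ⟶ X} {y : X ⟶ C} {δ : Extn S.E C A}
    (h : S.IsTriangle x y δ) : S.ConfObj A X C :=
  ⟨x, y, δ, h⟩

theorem IsTriangle.exists_iso {A X C X' : B} {x : A ⟶ X} {y : X ⟶ C} {x' : A ⟶ X'} {y' : X' ⟶ C}
    {δ : Extn S.E C A} (h : S.IsTriangle x y δ) (h' : S.IsTriangle x' y' δ) :
    Nonempty (X ≅ X') :=
  let ⟨b, _⟩ := (S.triangle_iff h x' y').1 h'
  ⟨b⟩

theorem ConfObj.nonempty_iso {A X C : B} (h : S.ConfObj A X C) (hs : Subsingleton (Extn S.E C A)) :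
    Nonempty (X ≅ A ⊞ C) := by
  obtain ⟨x, y, δ, h⟩ := h
  rw [Subsingleton.elim δ 0] at h
  exact h.exists_iso (S.triangle_zero A C)

theorem IsTilting.subcategory [S.EnoughProjectives] {T : ObjectProperty B}
    (h : S.IsTilting T) : IsAdditiveSubcategory T :=
  h.choose_spec.subcategory

theorem IsCotilting.subcategory [S.EnoughProjectives] {T : ObjectProperty B}
    (h : S.IsCotilting T) : IsAdditiveSubcategory T :=
  h.choose_spec.subcategory

variable [HasZeroObject B]

theorem ConfObj.of_iso {A X C A' C' : B} (h : S.ConfObj A X C) (a : A ≅ A') (c : C ≅ C') :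
    S.ConfObj A' X C' := by
  obtain ⟨x, y, δ, h⟩ := h
  obtain ⟨X', x', y', h'⟩ := S.exists_triangle (Extn.push a.hom (Extn.pull c.inv δ))
  have hac : Extn.push a.hom δ = Extn.pull c.hom (Extn.push a.hom (Extn.pull c.inv δ)) := by
    rw [← Extn.push_pull, ← Extn.pull_comp]
    simp
  obtain ⟨b, hx, hy⟩ := S.realize h h' a.hom c.hom hac
  have := h.isIso_mid h' a c hac hx hy
  exact (h'.of_iso (asIso b).symm).confObj

/-- `M` realizes the extension of `Z ⊞ W` by `A` with components `δ` and `δ'`. By (ET4)ᵒᵖ the kernel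
of `M ⟶ W` realizes the restriction `δ` to `Z`, so it is `X`; the braiding gives the other
conflation. -/
theorem ConfObj.pushout {A X Z Y W : B} (h : S.ConfObj A X Z) (h' : S.ConfObj A Y W) :
    ∃ M, S.ConfObj Y M Z ∧ S.ConfObj X M W := by
  have key : ∀ {U V : B} (δ : Extn S.E (U ⊞ V) A) {N M : B} {n : A ⟶ N} {n' : N ⟶ U}
      {m : A ⟶ M} {m' : M ⟶ U ⊞ V}, S.IsTriangle n n' (Extn.pull biprod.inl δ) →
      S.IsTriangle m m' δ → S.ConfObj N M V := by
    intro U V δ N M n n' m m' hn hm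
    obtain ⟨K, d, e, k, δ'', -, -, hk, hde, -, -⟩ := S.et4_op hm (S.triangle_zero U V)
    obtain ⟨b⟩ := hde.exists_iso hn
    exact hk.confObj.of_iso b (Iso.refl _)
  obtain ⟨x, y, δ, hδ⟩ := h
  obtain ⟨x', y', δ', hδ'⟩ := h'
  set μ := Extn.pull (biprod.fst : Z ⊞ W ⟶ Z) δ + Extn.pull (biprod.snd : Z ⊞ W ⟶ W) δ' with hμ
  obtain ⟨M, m, m', hm⟩ := S.exists_triangle μ
  have h₁ : Extn.pull biprod.inl μ = δ := by
    rw [hμ, Extn.pull_add, ← Extn.pull_comp, ← Extn.pull_comp]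
    simp [S.zero_pull]
  have h₂ : Extn.pull biprod.inr μ = δ' := by
    rw [hμ, Extn.pull_add, ← Extn.pull_comp, ← Extn.pull_comp]
    simp [S.zero_pull]
  obtain ⟨M', n, n', hn⟩ := S.exists_triangle (Extn.pull (biprod.braiding W Z).hom μ)
  have h₃ : Extn.pull biprod.inl (Extn.pull (biprod.braiding W Z).hom μ) = δ' := by
    rw [← Extn.pull_comp, ← h₂]
    congr 1
    ext <;> simp
  obtain ⟨b, hb, hb'⟩ := S.realize hn hm (𝟙 A) (biprod.braiding W Z).hom (by simp)
  have : IsIso b := hn.isIso_mid hm (Iso.refl A) (biprod.braiding W Z) (by simp) hb hb'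
  refine ⟨M, ?_, key μ (by rwa [h₁]) hm⟩
  have hm' : S.ConfObj Y M' Z := key _ (by rw [h₃]; exact hδ') hn
  obtain ⟨p, q, ε, hp⟩ := hm'
  exact (hp.of_iso (asIso b)).confObj

theorem ConfObj.pullback {A X Z Y W : B} (h : S.ConfObj Z X A) (h' : S.ConfObj W Y A) :
    ∃ M, S.ConfObj Z M Y ∧ S.ConfObj W M X := by
  have key : ∀ {U V : B} (δ : Extn S.E A (U ⊞ V)) {N M : B} {n : V ⟶ N} {n' : N ⟶ A}
      {m : U ⊞ V ⟶ M} {m' : M ⟶ A}, S.IsTriangle n n' (Extn.push biprod.snd δ) →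
      S.IsTriangle m m' δ → S.ConfObj U M N := by
    intro U V δ N M n n' m m' hn hm
    obtain ⟨K, k, d, e, δ'', -, -, hk, hde, -, -⟩ := S.et4 (S.triangle_zero U V) hm
    obtain ⟨b⟩ := hde.exists_iso hn
    exact hk.confObj.of_iso (Iso.refl _) b
  obtain ⟨x, y, δ, hδ⟩ := h
  obtain ⟨x', y', δ', hδ'⟩ := h'
  set μ := Extn.push (biprod.inl : Z ⟶ Z ⊞ W) δ + Extn.push (biprod.inr : W ⟶ Z ⊞ W) δ' with hμ
  obtain ⟨M, m, m', hm⟩ := S.exists_triangle μ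
  have h₁ : Extn.push biprod.fst μ = δ := by
    rw [hμ, Extn.push_add, ← Extn.push_comp, ← Extn.push_comp]
    simp [S.zero_push]
  have h₂ : Extn.push biprod.snd μ = δ' := by
    rw [hμ, Extn.push_add, ← Extn.push_comp, ← Extn.push_comp]
    simp [S.zero_push]
  obtain ⟨M', n, n', hn⟩ := S.exists_triangle (Extn.push (biprod.braiding Z W).hom μ)
  have h₃ : Extn.push biprod.snd (Extn.push (biprod.braiding Z W).hom μ) = δ := by
    rw [← Extn.push_comp]
    simpa using h₁
  obtain ⟨b, hb, hb'⟩ := S.realize hm hn (biprod.braiding Z W).hom (𝟙 A) (by simp)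
  have : IsIso b := hm.isIso_mid hn (biprod.braiding Z W) (Iso.refl A) (by simp) hb hb'
  refine ⟨M, key μ (by rwa [h₂]) hm, ?_⟩
  have hm' : S.ConfObj W M' X := key _ (by rw [h₃]; exact hδ) hn
  obtain ⟨p, q, ε, hp⟩ := hm'
  exact (hp.of_iso (asIso b).symm).confObj

/-- `A ⊞ D` serves as `Y`: the kernel of `A ⊞ D ⟶ D ⟶ F` is an extension of `Z` by `A`, so it is `X`
since `E(Z, A) = 0`. -/
theorem ConfObj.split_extend {A X Z D F : B} (h : S.ConfObj A X Z)
    (hs : Subsingleton (Extn S.E Z A)) (h' : S.ConfObj Z D F) :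
    ∃ Y, S.ConfObj A Y D ∧ S.ConfObj X Y F := by
  obtain ⟨x, y, δ, hδ⟩ := h
  obtain ⟨x', y', δ', hδ'⟩ := h'
  obtain ⟨K, d, e, k, δ'', -, -, hk, hde, -, -⟩ := S.et4_op (S.triangle_zero A D) hδ'
  rw [Subsingleton.elim (Extn.pull x' _) δ] at hde
  obtain ⟨b⟩ := hde.exists_iso hδ
  exact ⟨A ⊞ D, (S.triangle_zero A D).confObj, hk.confObj.of_iso b (Iso.refl _)⟩

theorem ConfObj.split_lift {A X Z D F : B} (h : S.ConfObj Z X A)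
    (hs : Subsingleton (Extn S.E A Z)) (h' : S.ConfObj F D Z) :
    ∃ Y, S.ConfObj D Y A ∧ S.ConfObj F Y X := by
  obtain ⟨x, y, δ, hδ⟩ := h
  obtain ⟨x', y', δ', hδ'⟩ := h'
  obtain ⟨K, k, d, e, δ'', -, -, hk, hde, -, -⟩ := S.et4 hδ' (S.triangle_zero D A)
  rw [Subsingleton.elim (Extn.push y' _) δ] at hde
  obtain ⟨b⟩ := hde.exists_iso hδ
  exact ⟨D ⊞ A, (S.triangle_zero D A).confObj, hk.confObj.of_iso (Iso.refl _) b⟩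

theorem projectives_iff {P : B} : S.projectives P ↔ ∀ Y, Subsingleton (Extn S.E P Y) := by
  constructor
  · intro hP Y
    refine subsingleton_of_forall_eq 0 fun δ => ?_
    obtain ⟨X, x, y, h⟩ := S.exists_triangle δ
    rw [← Extn.pull_id δ]
    exact (h.exists_lift_iff _).1 (hP x y ⟨δ, h⟩ (𝟙 P))
  · rintro hP A X C x y ⟨δ, h⟩ c
    exact (h.exists_lift_iff c).2 (Subsingleton.elim _ _)

theorem injectives_iff {I : B} : S.injectives I ↔ ∀ Y, Subsingleton (Extn S.E Y I) := by
  constructor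
  · intro hI Y
    refine subsingleton_of_forall_eq 0 fun δ => ?_
    obtain ⟨X, x, y, h⟩ := S.exists_triangle δ
    rw [← Extn.push_id δ]
    exact (h.exists_desc_iff _).1 (hI x y ⟨δ, h⟩ (𝟙 I))
  · rintro hI A X C x y ⟨δ, h⟩ a
    exact (h.exists_desc_iff a).2 (Subsingleton.elim _ _)

theorem isAdditiveSubcategory_projectives : IsAdditiveSubcategory S.projectives where
  of_iso e h := projectives_iff.2 fun Y =>
    Extn.subsingleton_of_retract_left e.inv e.hom e.inv_hom_id (projectives_iff.1 h Y)
  zero h _ _ _ _ _ _ _ := ⟨0, h.eq_of_src _ _⟩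
  sum {X X'} h h' := projectives_iff.2 fun Y =>
    (S.triangle_zero X X').subsingleton_mid_left (projectives_iff.1 h Y) (projectives_iff.1 h' Y)
  summand h := projectives_iff.2 fun Y =>
    Extn.subsingleton_of_retract_left biprod.inl biprod.fst biprod.inl_fst
      (projectives_iff.1 h Y)

theorem isAdditiveSubcategory_injectives : IsAdditiveSubcategory S.injectives where
  of_iso e h := injectives_iff.2 fun Y =>
    Extn.subsingleton_of_retract_right e.inv e.hom e.inv_hom_id (injectives_iff.1 h Y)
  zero h _ _ _ _ _ _ _ := ⟨0, h.eq_of_tgt _ _⟩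
  sum {X X'} h h' := injectives_iff.2 fun Y =>
    (S.triangle_zero X X').subsingleton_mid_right (injectives_iff.1 h Y) (injectives_iff.1 h' Y)
  summand h := injectives_iff.2 fun Y =>
    Extn.subsingleton_of_retract_right biprod.inl biprod.fst biprod.inl_fst
      (injectives_iff.1 h Y)

/-- Dimension shifting: `E(ΩX, Y)` vanishes if and only if `E(X, ΣY)` does. -/
theorem ConfObj.subsingleton_shift {A P X Y I Z : B} (h : S.ConfObj A P X)
    (hP : ∀ Y, Subsingleton (Extn S.E P Y)) (h' : S.ConfObj Y I Z)
    (hI : ∀ Y, Subsingleton (Extn S.E Y I)) :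
    Subsingleton (Extn S.E A Y) ↔ Subsingleton (Extn S.E X Z) := by
  obtain ⟨x, y, δ, hδ⟩ := h
  obtain ⟨i, j, ε, hε⟩ := h'
  constructor
  · intro _
    refine subsingleton_of_forall_eq 0 fun θ => ?_
    obtain ⟨a, rfl⟩ := hδ.exists_push_eq θ ((hP Z).elim _ _)
    obtain ⟨b, rfl⟩ := (hε.exists_lift_iff a).2 (Subsingleton.elim _ _)
    rw [Extn.push_comp, (hI X).elim (Extn.push b δ) 0, Extn.push_zero]
  · intro _
    refine subsingleton_of_forall_eq 0 fun θ => ?_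
    obtain ⟨a, rfl⟩ := hε.exists_pull_eq θ ((hI A).elim _ _)
    obtain ⟨p, rfl⟩ := (hδ.exists_desc_iff a).2 (Subsingleton.elim _ _)
    rw [Extn.pull_comp, (hP Y).elim (Extn.pull p ε) 0, Extn.pull_zero]

variable (S) in
theorem exists_confObj_inj [S.EnoughInjectives] (X : B) :
    ∃ A I, (∀ Y, Subsingleton (Extn S.E Y I)) ∧ S.ConfObj X I A := by
  obtain ⟨I, A, x, y, hI, h⟩ := EnoughInjectives.exists_conflation (S := S) X
  exact ⟨A, I, injectives_iff.1 hI, x, y, h⟩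

variable [S.EnoughProjectives]

variable (S) in
theorem confObj_syzygy (X : B) : ∃ P, (∀ Y, Subsingleton (Extn S.E P Y)) ∧
    S.ConfObj (S.syzygy X) P X := by
  obtain ⟨P, x, y, hP, h⟩ := (EnoughProjectives.exists_conflation (S := S) X).choose_spec
  exact ⟨P, projectives_iff.1 hP, x, y, h⟩

theorem subsingleton_iterSyzygy_shift_right {Y I Z : B} (h : S.ConfObj Y I Z)
    (hI : ∀ Y, Subsingleton (Extn S.E Y I)) (i : ℕ) (X : B) :
    Subsingleton (Extn S.E (S.iterSyzygy i X) Z) ↔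
      Subsingleton (Extn S.E (S.iterSyzygy (i + 1) X) Y) :=
  let ⟨_, hP, h'⟩ := S.confObj_syzygy (S.iterSyzygy i X)
  (h'.subsingleton_shift hP h hI).symm

variable [S.EnoughInjectives]

/-- `A` need not be the chosen syzygy of `X`. Trading syzygies for cosyzygies of `Y` reduces to
degree zero, where any conflation with projective middle term can be used. -/
theorem subsingleton_iterSyzygy_shift_left {A P X : B} (h : S.ConfObj A P X)
    (hP : ∀ Y, Subsingleton (Extn S.E P Y)) (i : ℕ) (Y : B) :
    Subsingleton (Extn S.E (S.iterSyzygy i A) Y) ↔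
      Subsingleton (Extn S.E (S.iterSyzygy (i + 1) X) Y) := by
  obtain ⟨Z, I, hI, hY⟩ := S.exists_confObj_inj Y
  induction i generalizing Y Z I with
  | zero =>
    rw [← subsingleton_iterSyzygy_shift_right hY hI]
    exact h.subsingleton_shift hP hY hI
  | succ i ih =>
    rw [← subsingleton_iterSyzygy_shift_right hY hI, ← subsingleton_iterSyzygy_shift_right hY hI]
    obtain ⟨Z', I', hI', hZ⟩ := S.exists_confObj_inj Z
    exact ih Z Z' I' hI' hZ

open ZeroObject

variable (S) in
/-- The conflation calculus of an extriangulated category. -/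
noncomputable def calculus : ConflationCalculus B where
  Conf := S.ConfObj
  Vanish i X Y := Subsingleton (Extn S.E (S.iterSyzygy i X) Y)
  zero := 0
  conf_zero_right X := (S.triangle_id_left X).confObj
  conf_zero_left X := (S.triangle_id_right X).confObj
  pushout := ConfObj.pushout
  pullback := ConfObj.pullback
  comp := by
    rintro A X D Y F ⟨x, y, δ, h⟩ ⟨x', y', δ', h'⟩
    obtain ⟨Z, _, _, _, _, -, -, h₁, h₂, -⟩ := S.et4 h h'
    exact ⟨Z, h₁.confObj, h₂.confObj⟩
  comp_op := by
    rintro A X D Y F ⟨x, y, δ, h⟩ ⟨x', y', δ', h'⟩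
    obtain ⟨Z, _, _, _, _, -, -, h₁, h₂, -⟩ := S.et4_op h' h
    exact ⟨Z, h₁.confObj, h₂.confObj⟩
  split_extend h hs h' := h.split_extend hs h'
  split_lift h hs h' := h.split_lift hs h'
  vanish_zero_mid _ := fun ⟨_, _, _, h⟩ hA hZ => h.subsingleton_mid_right hA hZ
  vanish_zero_mid_op _ := fun ⟨_, _, _, h⟩ hA hZ => h.subsingleton_mid_left hZ hA
  vanish_zero_split W h hs hX :=
    let ⟨e⟩ := h.nonempty_iso hs
    Extn.subsingleton_of_retract_right (biprod.inr ≫ e.inv) (e.hom ≫ biprod.snd) (by simp) hX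
  vanish_zero_split_op {_ X Z} W h hs hX :=
    let ⟨e⟩ := h.nonempty_iso hs
    Extn.subsingleton_of_retract_left (C := Z) (C' := X) (biprod.inl ≫ e.inv)
      (e.hom ≫ biprod.fst) (by simp) hX
  enough_proj X := ⟨_, S.confObj_syzygy X⟩
  enough_inj := S.exists_confObj_inj
  shift_proj i Y hP h := subsingleton_iterSyzygy_shift_left h hP i Y
  shift_inj i Y hI h := subsingleton_iterSyzygy_shift_right h hI i Y

theorem splitClosed {T : ObjectProperty B} (hT : IsAdditiveSubcategory T) :
    S.calculus.SplitClosed T where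
  zero := hT.zero (isZero_zero B)
  mid h hs hA hZ :=
    let ⟨e⟩ := ConfObj.nonempty_iso h hs
    hT.of_iso e.symm (hT.sum hA hZ)
  left h hs hX :=
    let ⟨e⟩ := ConfObj.nonempty_iso h hs
    hT.summand (hT.of_iso e hX)
  right h hs hX :=
    let ⟨e⟩ := ConfObj.nonempty_iso h hs
    hT.summand (hT.of_iso (e ≪≫ biprod.braiding _ _) hX)

/-! ### Translation between the category and its calculus -/

theorem calculus_proj_iff {P : B} : S.calculus.Proj P ↔ S.projectives P :=
  projectives_iff.symm

theorem calculus_inj_iff {I : B} : S.calculus.Inj I ↔ S.injectives I :=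
  injectives_iff.symm

theorem calculus_vee_iff {T : ObjectProperty B} {n : ℕ} {X : B} :
    S.calculus.Vee T n X ↔ S.vee T n X := by
  induction n generalizing X with
  | zero => rfl
  | succ n ih =>
    constructor
    · rintro ⟨Y, Z, hY, hZ, x, y, h⟩
      exact ⟨Y, Z, x, y, hY, ih.1 hZ, h⟩
    · rintro ⟨Y, Z, x, y, hY, hZ, h⟩
      exact ⟨Y, Z, hY, ih.2 hZ, x, y, h⟩

theorem calculus_wedge_iff {T : ObjectProperty B} {n : ℕ} {X : B} :
    S.calculus.op.Vee T n X ↔ S.wedge T n X := by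
  induction n generalizing X with
  | zero => rfl
  | succ n ih =>
    constructor
    · rintro ⟨Y, Z, hY, hZ, x, y, h⟩
      exact ⟨Z, Y, x, y, ih.1 hZ, hY, h⟩
    · rintro ⟨Z, Y, x, y, hZ, hY, h⟩
      exact ⟨Y, Z, hY, ih.2 hZ, x, y, h⟩

theorem pd_le_iff {n : ℕ} {X : B} : S.pd X ≤ n ↔ S.calculus.PdLE n X := by
  simp only [pd, iSup_le_iff, Set.mem_ofPred_eq, Nat.cast_le, and_imp, forall_exists_index]
  constructor
  · intro h i hi Y
    by_contra hY
    -- `Vanish i` concerns `E^(i+1)`, so `n ≤ i` means degree greater than `n`.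
    have := h (i + 1) (by omega) Y (not_subsingleton_iff_nontrivial.1 hY)
    omega
  · intro h i hi Y hY
    by_contra hn
    exact not_subsingleton_iff_nontrivial.2 hY (h (i - 1) (by omega) Y)

theorem injd_le_iff {n : ℕ} {X : B} : S.injd X ≤ n ↔ S.calculus.IdLE n X := by
  simp only [injd, iSup_le_iff, Set.mem_ofPred_eq, Nat.cast_le, and_imp, forall_exists_index]
  constructor
  · intro h i hi Y
    by_contra hY
    have := h (i + 1) (by omega) Y (not_subsingleton_iff_nontrivial.1 hY)
    omega
  · intro h i hi Y hY
    by_contra hn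
    exact not_subsingleton_iff_nontrivial.2 hY (h (i - 1) (by omega) Y)

theorem pdClass_le_iff {n : ℕ} {T : ObjectProperty B} :
    S.pdClass T ≤ n ↔ ∀ X, T X → S.calculus.PdLE n X := by
  simp only [pdClass, iSup_le_iff, pd_le_iff]

theorem injdClass_le_iff {n : ℕ} {T : ObjectProperty B} :
    S.injdClass T ≤ n ↔ ∀ X, T X → S.calculus.IdLE n X := by
  simp only [injdClass, iSup_le_iff, injd_le_iff]

theorem enat_lt_top_iff_exists_le {a : ℕ∞} : a < ⊤ ↔ ∃ n : ℕ, a ≤ n :=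
  ⟨fun h => ⟨a.toNat, (ENat.natCast_toNat h.ne).ge⟩, fun ⟨n, h⟩ => h.trans_lt (ENat.natCast_lt_top n)⟩

theorem isGorenstein_iff : S.IsGorenstein ↔
    (∃ n, ∀ I, S.calculus.Inj I → S.calculus.PdLE n I) ∧
      ∃ n, ∀ P, S.calculus.Proj P → S.calculus.IdLE n P := by
  simp only [IsGorenstein, enat_lt_top_iff_exists_le, pdClass_le_iff, injdClass_le_iff,
    calculus_proj_iff, calculus_inj_iff]

/-- Beyond degree `n` orthogonality follows from the dimension bound, so requiring it in all degrees
loses nothing. -/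
theorem isTilting_iff {T : ObjectProperty B} (hT : IsAdditiveSubcategory T) :
    S.IsTilting T ↔ S.calculus.Tilting T := by
  constructor
  · rintro ⟨n, hn⟩
    have hpd := pdClass_le_iff.1 hn.pd_le
    refine ⟨fun {X Y} hX hY i => ?_, n, hpd, fun P hP => ?_⟩
    · by_cases hi : n ≤ i
      · exact hpd X hX i hi Y
      · exact hn.ext_eq_zero (i + 1) (by omega) (by omega) X Y hX hY
    · exact calculus_vee_iff.2 (hn.projectives_le P (calculus_proj_iff.1 hP))
  · rintro ⟨hV, n, hn, hP⟩
    -- The bound `n` may be `0` in the calculus, while a tilting subcategory needs `n ≥ 1`.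
    exact ⟨n + 1, hT, by omega,
      pdClass_le_iff.2 fun X hX i hi => hn X hX i (by omega),
      fun i _ _ X Y hX hY => hV hX hY (i - 1), fun P h => calculus_vee_iff.1
        (ConflationCalculus.vee_succ (splitClosed hT) (hP P (calculus_proj_iff.2 h)))⟩

theorem isCotilting_iff {T : ObjectProperty B} (hT : IsAdditiveSubcategory T) :
    S.IsCotilting T ↔ S.calculus.op.Tilting T := by
  constructor
  · rintro ⟨n, hn⟩
    have hid := injdClass_le_iff.1 hn.injd_le
    refine ⟨fun {X Y} hX hY i => ?_, n, hid, fun I hI => ?_⟩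
    · by_cases hi : n ≤ i
      · exact hid X hX i hi Y
      · exact hn.ext_eq_zero (i + 1) (by omega) (by omega) Y X hY hX
    · exact calculus_wedge_iff.2 (hn.injectives_le I (calculus_inj_iff.1 hI))
  · rintro ⟨hV, n, hn, hI⟩
    exact ⟨n + 1, hT, by omega,
      injdClass_le_iff.2 fun X hX i hi => hn X hX i (by omega),
      fun i _ _ X Y hX hY => hV hY hX (i - 1), fun I h => calculus_wedge_iff.1
        (ConflationCalculus.vee_succ (splitClosed hT).op (hI I (calculus_inj_iff.2 h)))⟩

/-! ### The implications of the theorem -/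

variable (S) in
theorem isTilting_projectives : S.IsTilting S.projectives := by
  rw [isTilting_iff isAdditiveSubcategory_projectives,
    ← funext fun P => propext (calculus_proj_iff (S := S) (P := P))]
  exact ConflationCalculus.tilting_proj _

variable (S) in
theorem isCotilting_injectives : S.IsCotilting S.injectives := by
  rw [isCotilting_iff isAdditiveSubcategory_injectives,
    ← funext fun I => propext (calculus_inj_iff (S := S) (I := I))]
  exact ConflationCalculus.tilting_proj _

theorem IsGorenstein.isCotilting (hS : S.IsGorenstein) {T : ObjectProperty B}
    (h : S.IsTilting T) : S.IsCotilting T := by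
  obtain ⟨hI, hP⟩ := isGorenstein_iff.1 hS
  exact (isCotilting_iff h.subcategory).2
    (((isTilting_iff h.subcategory).1 h).cotilting (splitClosed h.subcategory) hI hP)

theorem IsGorenstein.isTilting (hS : S.IsGorenstein) {T : ObjectProperty B}
    (h : S.IsCotilting T) : S.IsTilting T := by
  obtain ⟨hI, hP⟩ := isGorenstein_iff.1 hS
  exact (isTilting_iff h.subcategory).2
    (((isCotilting_iff h.subcategory).1 h).cotilting (splitClosed h.subcategory).op hP hI)

theorem IsTilting.isGorenstein {T : ObjectProperty B} (h : S.IsTilting T)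
    (h' : S.IsCotilting T) : S.IsGorenstein := by
  have h₁ := (isTilting_iff h.subcategory).1 h
  have h₂ := (isCotilting_iff h.subcategory).1 h'
  exact isGorenstein_iff.2 ⟨h₂.exists_idLE h₁, h₁.exists_idLE h₂⟩

end

end Extriangulation

theorem theorem5p10 {k : Type*} [Field k] {B : Type u} [Category.{v} B] [Preadditive B]
    [HasZeroObject B] [HasBinaryBiproducts B]
    [Linear k B] (S : Extriangulation.{w} B)
    (hKS : IsKrullSchmidt B) (hHom : IsHomFinite k B)
    [S.EnoughProjectives] [S.EnoughInjectives] (hWIC : S.WIC) (hAF : S.AF) :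
    List.TFAE [
      S.IsGorenstein,
      ∀ T : ObjectProperty B, S.IsTilting T → S.IsCotilting T,
      ∀ T : ObjectProperty B, S.IsCotilting T → S.IsTilting T,
      ∃ T : ObjectProperty B, S.IsTilting T ∧ S.IsCotilting T] := by
  tfae_have 1 → 2 := fun hS _ h => hS.isCotilting h
  tfae_have 1 → 3 := fun hS _ h => hS.isTilting h
  tfae_have 2 → 4 := fun h => ⟨_, S.isTilting_projectives, h _ S.isTilting_projectives⟩
  tfae_have 3 → 4 := fun h => ⟨_, h _ S.isCotilting_injectives, S.isCotilting_injectives⟩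
  tfae_have 4 → 1 := fun ⟨_, h, h'⟩ => h.isGorenstein h'
  tfae_finish
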